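/- Let $F$ be a field. All algebras are unital associative $F$-algebras. An algebra $A$ is a *locally matrix algebra* if every finite subset of $A$ lies in a subalgebra $B$ with $1_A\in B$ and $B\cong M_n(F)$ for some $n\ge 1$. A *Steinitz number* is a formal product $s=\prod_p p^{r_p}$ over all primes with $r_p\in\{0,1,2,\dots,\infty\}$; Steinitz numbers are multiplied by adding exponents, and $s$ is *locally finite* if no $r_p$ is $\infty$. The Steinitz number $\mathbf{st}(A)$ is the least common multiple of all $n\ge 1$ such that $A$ has a subalgebra $A'\ni 1_A$ with $A'\cong M_n(F)$. For Steinitz numbers $s_1,s_2$ and a rational $q=m/n>0$ ($m,n\ge 1$ coprime integers) we write $s_1=q\cdot s_2$, and call $q$ a value of the ratio $s_1/s_2$, if $n\cdot s_1=m\cdot s_2$. We write $s_1/s_2<1$ if $s_1=q\cdot s_2$ for some rational $q$ with $0<q<1$. Algebras are Morita equivalent if their categories of left modules are equivalent. A *proper corner* of $A$ is an algebra $eAe$ with $e=e^2\in A$, $e\ne 1$ (with identity element $e$). (1) Let $A_1,A_2$ be Morita equivalent locally matrix algebras of at most countable dimension. Then $\mathbf{st}(A_1)=q\cdot\mathbf{st}(A_2)$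 for some rational $q>0$, and $\mathbf{st}(A_1)/\mathbf{st}(A_2)<1$ if and only if $A_1$ is isomorphic to a proper corner $eA_2e$ of $A_2$. (2) Let $A$ be a locally matrix algebra of at most countable dimension, and on the class of all locally matrix algebras of at most countable dimension that are Morita equivalent to $A$ write $A_1<A_2$ if $\mathbf{st}(A_1)/\mathbf{st}(A_2)<1$. Then $<$ is transitive, and for any $A_1,A_2$ in the class $A_1<A_2$ or $A_1\cong A_2$ or $A_2<A_1$. If, moreover, $\mathbf{st}(A)$ is locally finite, then the ratio $\mathbf{st}(A_1)/\mathbf{st}(A_2)$ is a unique rational number for all $A_1,A_2$ in the class, and exactly one of $A_1<A_2$, $A_1\cong A_2$, $A_2<A_1$ holds; that is, the isomorphism classes in the Morita class are strictly linearly ordered by the ratio of Steinitz numbers. -/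

import Mathlib

/-- A Steinitz (supernatural) number `∏ p ^ (r p)`, given by its exponents
`r p ∈ {0, 1, 2, …, ∞}`, one for every prime `p`. -/
@[ext]
structure SteinitzNumber where
  /-- The exponent of a prime. -/
  exponent : Nat.Primes → ℕ∞

namespace SteinitzNumber

/-- The product of two Steinitz numbers: exponents are added. -/
instance : Mul SteinitzNumber := ⟨fun s t => ⟨fun p => s.exponent p + t.exponent p⟩⟩

/-- A positive integer as a Steinitz number. -/
def ofPNat (n : ℕ+) : SteinitzNumber := ⟨fun p => ((n : ℕ).factorization p : ℕ∞)⟩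

/-- The least common multiple of a set of positive integers: the exponent of `p` is the supremum
of the exponents of `p` in the members of the set. -/
noncomputable def lcm (S : Set ℕ+) : SteinitzNumber :=
  ⟨fun p => ⨆ n ∈ S, (ofPNat n).exponent p⟩

/-- No exponent is infinite. -/
def IsLocallyFinite (s : SteinitzNumber) : Prop := ∀ p, s.exponent p ≠ ⊤

/-- `IsRatio q s t`: the positive rational number `q` is a value of the ratio `s / t`, that is,
`s = q • t`, in the sense that `n s = m t` for `q = m / n` in lowest terms. -/
def IsRatio (q : ℚ) (s t : SteinitzNumber) : Prop :=
  ∃ m n : ℕ+, q = (m : ℚ) / (n : ℚ) ∧ Nat.Coprime m n ∧ ofPNat n * s = ofPNat m * t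

/-- `s` and `t` differ by a rational factor. -/
def RationallyConnected (s t : SteinitzNumber) : Prop := ∃ q : ℚ, IsRatio q s t

/-- `s / t < 1`: some rational `q < 1` satisfies `s = q • t`. -/
def RatioLTOne (s t : SteinitzNumber) : Prop := ∃ q : ℚ, q < 1 ∧ IsRatio q s t

end SteinitzNumber

universe u v

/-- A unital locally matrix algebra over `F`: every finite set of elements lies in a unital
subalgebra isomorphic to a matrix algebra `M_n(F)` with `n ≥ 1`. -/
def IsLocallyMatrixAlgebra (F : Type v) [Field F] (A : Type u) [Ring A] [Algebra F A] : Prop :=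
  ∀ S : Finset A, ∃ (B : Subalgebra F A) (n : ℕ+),
    (S : Set A) ⊆ B ∧ Nonempty (B ≃ₐ[F] Matrix (Fin n) (Fin n) F)

/-- A unital locally matrix algebra whose dimension over `F` is at most countable. -/
def IsCountableLocallyMatrixAlgebra (F : Type v) [Field F] (A : Type u) [Ring A] [Algebra F A] :
    Prop :=
  IsLocallyMatrixAlgebra F A ∧ Module.rank F A ≤ Cardinal.aleph0

/-- The set of all `n ≥ 1` such that `A` has a unital subalgebra isomorphic to `M_n(F)`. -/
def matrixDegrees (F : Type v) [Field F] (A : Type u) [Ring A] [Algebra F A] : Set ℕ+ :=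
  {n | ∃ B : Subalgebra F A, Nonempty (B ≃ₐ[F] Matrix (Fin n) (Fin n) F)}

/-- The Steinitz number of `A`. -/
noncomputable def steinitzNumber (F : Type v) [Field F] (A : Type u) [Ring A] [Algebra F A] :
    SteinitzNumber :=
  SteinitzNumber.lcm (matrixDegrees F A)

/-- Morita equivalence: the categories of left modules are equivalent. -/
def AreMoritaEquivalent (A B : Type u) [Ring A] [Ring B] : Prop :=
  Nonempty (CategoryTheory.Equivalence (ModuleCat.{u} A) (ModuleCat.{u} B))

/-- The corner `e A e`, whose identity element is `e`, as an algebra over `F`. -/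
noncomputable instance IsIdempotentElem.Corner.instAlgebra (F : Type v) [Field F]
    {A : Type u} [Ring A] [Algebra F A] {e : A} (he : IsIdempotentElem e) :
    Algebra F he.Corner where
  smul c x := ⟨c • x.1, (Subsemigroup.mem_corner_iff he).2
    ⟨by rw [mul_smul_comm, ((Subsemigroup.mem_corner_iff he).1 x.2).1],
     by rw [smul_mul_assoc, ((Subsemigroup.mem_corner_iff he).1 x.2).2]⟩⟩
  algebraMap :=
    { toFun := fun c => ⟨c • e, (Subsemigroup.mem_corner_iff he).2
        ⟨by rw [mul_smul_comm, he.eq], by rw [smul_mul_assoc, he.eq]⟩⟩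
      map_one' := Subtype.ext (one_smul F e)
      map_mul' := fun c d => Subtype.ext (by
        change (c * d) • e = (c • e) * (d • e)
        rw [smul_mul_smul_comm, he.eq])
      map_zero' := Subtype.ext (zero_smul F e)
      map_add' := fun c d => Subtype.ext (add_smul c d e) }
  commutes' c x := Subtype.ext (by
    change (c • e) * x.1 = x.1 * (c • e)
    rw [smul_mul_assoc, mul_smul_comm, ((Subsemigroup.mem_corner_iff he).1 x.2).1,
      ((Subsemigroup.mem_corner_iff he).1 x.2).2])
  smul_def' c x := Subtype.ext (by
    change c • x.1 = (c • e) * x.1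
    rw [smul_mul_assoc, ((Subsemigroup.mem_corner_iff he).1 x.2).1])

/-- `A` is isomorphic, as an algebra, to a proper corner `e B e`, `e ≠ 1`, of `B`. -/
def IsIsomorphicToProperCorner (F : Type v) [Field F] (A B : Type u)
    [Ring A] [Algebra F A] [Ring B] [Algebra F B] : Prop :=
  ∃ (e : B) (he : IsIdempotentElem e), e ≠ 1 ∧ Nonempty (A ≃ₐ[F] he.Corner)

/-- The relation `A < B`, i.e. `st(A) / st(B) < 1`. -/
def SteinitzLT (F : Type v) [Field F] (A B : Type u)
    [Ring A] [Algebra F A] [Ring B] [Algebra F B] : Prop :=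
  (steinitzNumber F A).RatioLTOne (steinitzNumber F B)

/-- `B` is a countable-dimensional locally matrix algebra in the Morita class of `A`. -/
def InMoritaClass (F : Type v) [Field F] (A B : Type u)
    [Ring A] [Ring B] [Algebra F B] : Prop :=
  IsCountableLocallyMatrixAlgebra F B ∧ AreMoritaEquivalent A B

/-!
A unital homomorphism between matrix algebras `M_n(F) → M_N(F)` exists only if `N = n * k`, and
up to conjugation it is then `a ↦ a ⊗ 1_k` (`Matrix.exists_eq_conj_repeat`). Everything about a
locally matrix algebra `A` is deduced from this by passing to large matrix subalgebras. In particular the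
positive integers that divide `st(A)` are exactly the degrees of the unital matrix subalgebras of
`A` (`IsLocallyMatrixAlgebra.mem_matrixDegrees_of_le`).

Corners. An idempotent `e` of `A` lies in some matrix subalgebra of degree `n`, with rank `r`, say.
In a matrix subalgebra of degree `n * k` that contains the first one it has rank `r * k`, so there
it cuts out a matrix algebra of degree `r * k`. Hence `n * st(eAe) = r * st(A)`
(`IsLocallyMatrixAlgebra.steinitzNumber_corner`). In the same way `st(M_k(A)) = k * st(A)`
(`IsLocallyMatrixAlgebra.steinitzNumber_matrix`).

Morita equivalence. If `A₁` and `A₂` have equivalent module categories, then the `A₂`-module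
corresponding to `A₁` is finitely generated and projective, so that `A₁` is isomorphic, as a ring,
to a corner of some `M_k(A₂)` (`AreMoritaEquivalent.exists_ringEquiv_corner`). Matrix subalgebras
are given by matrix units, so the Steinitz number depends on the ring only
(`steinitzNumber_eq_of_ringEquiv`), and the formulas for corners and matrices make `st(A₁)` a
rational multiple of `st(A₂)`.

Glimm's theorem (`IsCountableLocallyMatrixAlgebra.nonempty_algEquiv`) says that algebras of at most
countable dimension with equal Steinitz numbers are isomorphic. It is proved by back-and-forth: the
finite stages are the matrix subalgebras of `A × C`, each of which is the graph of an isomorphism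
between its projections because matrix algebras are simple, and the union of a generic chain of such
graphs is the graph of an isomorphism.

If `n * st(A₁) = m * st(A₂)` with `m < n` coprime, then `n` divides `st(A₂)`, an idempotent of rank
`m` in a matrix subalgebra of degree `n` cuts out a proper corner with the same Steinitz number as
`A₁`, and Glimm's theorem identifies it with `A₁`. The statements on the order follow from Glimm's
theorem and arithmetic of Steinitz numbers.
-/

/-! ### Arithmetic of Steinitz numbers -/

namespace SteinitzNumber

@[simp]
theorem exponent_mul (s t : SteinitzNumber) (p : Nat.Primes) :
    (s * t).exponent p = s.exponent p + t.exponent p := rfl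

@[simp]
theorem exponent_ofPNat (n : ℕ+) (p : Nat.Primes) :
    (ofPNat n).exponent p = ((n : ℕ).factorization p : ℕ∞) := rfl

instance : CommSemigroup SteinitzNumber where
  mul_assoc _ _ _ := SteinitzNumber.ext (funext fun _ => add_assoc _ _ _)
  mul_comm _ _ := SteinitzNumber.ext (funext fun _ => add_comm _ _)

theorem ofPNat_mul (m n : ℕ+) : ofPNat (m * n) = ofPNat m * ofPNat n := by
  ext p
  simp [Nat.factorization_mul m.ne_zero n.ne_zero]

theorem exponent_add_eq {m n : ℕ+} {s t : SteinitzNumber} (h : ofPNat n * s = ofPNat m * t)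
    (p : Nat.Primes) : ((n : ℕ).factorization p : ℕ∞) + s.exponent p =
      ((m : ℕ).factorization p : ℕ∞) + t.exponent p :=
  congrArg (fun u => u.exponent p) h

theorem ofPNat_mul_cancel {n : ℕ+} {s t : SteinitzNumber} (h : ofPNat n * s = ofPNat n * t) :
    s = t := by
  ext p
  exact ENat.add_right_injective_of_ne_top (ENat.natCast_ne_top _) (exponent_add_eq h p)

/-- The numerator and the denominator of a ratio need not be coprime. -/
theorem IsRatio.of_mul_eq {s t : SteinitzNumber} {m n : ℕ+}
    (h : ofPNat n * s = ofPNat m * t) : IsRatio ((m : ℚ) / (n : ℚ)) s t := by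
  obtain ⟨d, m', n', hm, hn, hc⟩ : ∃ d m' n' : ℕ+, m = d * m' ∧ n = d * n' ∧
      Nat.Coprime m' n' := by
    obtain ⟨g, m', n', hg, hc, hm, hn⟩ := Nat.exists_coprime' (m := m) (n := n)
      (Nat.gcd_pos_of_pos_left _ m.pos)
    have hm0 : 0 < m' := Nat.pos_of_ne_zero fun h0 => m.ne_zero (by simp [hm, h0])
    have hn0 : 0 < n' := Nat.pos_of_ne_zero fun h0 => n.ne_zero (by simp [hn, h0])
    exact ⟨⟨g, hg⟩, ⟨m', hm0⟩, ⟨n', hn0⟩, PNat.eq (hm.trans (mul_comm _ _)),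
      PNat.eq (hn.trans (mul_comm _ _)), hc⟩
  refine ⟨m', n', ?_, hc, ?_⟩
  · have : (d : ℚ) ≠ 0 := by exact_mod_cast d.ne_zero
    subst hm hn
    push_cast
    exact mul_div_mul_left _ _ this
  · rw [hm, hn, ofPNat_mul, ofPNat_mul, mul_assoc, mul_assoc] at h
    exact ofPNat_mul_cancel h

theorem RationallyConnected.of_mul_eq {s t : SteinitzNumber} {m n : ℕ+}
    (h : ofPNat n * s = ofPNat m * t) : RationallyConnected s t :=
  ⟨_, IsRatio.of_mul_eq h⟩

theorem RatioLTOne.of_mul_eq {s t : SteinitzNumber} {m n : ℕ+} (hmn : m < n)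
    (h : ofPNat n * s = ofPNat m * t) : RatioLTOne s t := by
  refine ⟨_, ?_, IsRatio.of_mul_eq h⟩
  rw [div_lt_one (by exact_mod_cast n.pos)]
  exact_mod_cast hmn

theorem RatioLTOne.exists_mul_eq {s t : SteinitzNumber} (h : RatioLTOne s t) :
    ∃ m n : ℕ+, m < n ∧ Nat.Coprime m n ∧ ofPNat n * s = ofPNat m * t := by
  obtain ⟨q, hq, m, n, rfl, hc, h⟩ := h
  refine ⟨m, n, ?_, hc, h⟩
  rw [div_lt_one (by exact_mod_cast n.pos)] at hq
  exact_mod_cast hq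

theorem RatioLTOne.trans {s t u : SteinitzNumber} (h₁ : RatioLTOne s t) (h₂ : RatioLTOne t u) :
    RatioLTOne s u := by
  obtain ⟨m, n, hmn, -, h⟩ := h₁.exists_mul_eq
  obtain ⟨m', n', hmn', -, h'⟩ := h₂.exists_mul_eq
  refine RatioLTOne.of_mul_eq (m := m * m') (n := n * n') ?_ ?_
  · rw [← PNat.coe_lt_coe] at *
    push_cast
    exact Nat.mul_lt_mul_of_lt_of_lt hmn hmn'
  · rw [ofPNat_mul, ofPNat_mul, mul_assoc, mul_left_comm, h, mul_left_comm, h', mul_assoc]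

/-- Trichotomy for rationally connected Steinitz numbers. -/
theorem RationallyConnected.lt_or_eq_or_gt {s t : SteinitzNumber}
    (h : RationallyConnected s t) : RatioLTOne s t ∨ s = t ∨ RatioLTOne t s := by
  obtain ⟨q, m, n, -, -, h⟩ := h
  rcases lt_trichotomy m n with hmn | rfl | hmn
  · exact Or.inl (.of_mul_eq hmn h)
  · exact Or.inr (Or.inl (ofPNat_mul_cancel h))
  · exact Or.inr (Or.inr (.of_mul_eq hmn h.symm))

theorem RationallyConnected.isLocallyFinite {s t : SteinitzNumber}
    (h : RationallyConnected s t) (hs : s.IsLocallyFinite) : t.IsLocallyFinite := by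
  obtain ⟨q, m, n, -, -, h⟩ := h
  intro p hp
  have h' := exponent_add_eq h p
  rw [hp, add_top] at h'
  exact WithTop.add_ne_top.2 ⟨ENat.natCast_ne_top _, hs p⟩ h'

/-- For locally finite Steinitz numbers a ratio is determined by the differences of the
exponents, which are finite. -/
theorem IsRatio.unique {s t : SteinitzNumber} (hs : s.IsLocallyFinite) (ht : t.IsLocallyFinite)
    {q q' : ℚ} (h : IsRatio q s t) (h' : IsRatio q' s t) : q = q' := by
  obtain ⟨m, n, rfl, -, h⟩ := h
  obtain ⟨m', n', rfl, -, h'⟩ := h'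
  have key : (m * n' : ℕ) = m' * n := by
    refine Nat.eq_of_factorization_eq (mul_ne_zero m.ne_zero n'.ne_zero)
      (mul_ne_zero m'.ne_zero n.ne_zero) fun p => ?_
    by_cases hp : p.Prime
    · have e := exponent_add_eq h ⟨p, hp⟩
      have e' := exponent_add_eq h' ⟨p, hp⟩
      obtain ⟨a, ha⟩ := ENat.ne_top_iff_exists.1 (hs ⟨p, hp⟩)
      obtain ⟨b, hb⟩ := ENat.ne_top_iff_exists.1 (ht ⟨p, hp⟩)
      rw [← ha, ← hb] at e e'
      norm_cast at e e'
      rw [Nat.factorization_mul m.ne_zero n'.ne_zero, Nat.factorization_mul m'.ne_zero n.ne_zero,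
        Finsupp.add_apply, Finsupp.add_apply]
      change (m : ℕ).factorization p + _ = _ + (n : ℕ).factorization p
      simp only at e e'
      omega
    · simp [Nat.factorization_eq_zero_of_not_prime _ hp]
  rw [div_eq_div_iff (by exact_mod_cast n.ne_zero) (by exact_mod_cast n'.ne_zero)]
  exact_mod_cast key

theorem RatioLTOne.irrefl {s : SteinitzNumber} (hs : s.IsLocallyFinite) : ¬ RatioLTOne s s := by
  rintro ⟨q, hq, h⟩
  have h1 : IsRatio (((1 : ℕ+) : ℚ) / ((1 : ℕ+) : ℚ)) s s := .of_mul_eq rfl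
  rw [h.unique hs hs h1] at hq
  simp at hq

end SteinitzNumber

/-! ### Homomorphisms between matrix algebras -/

namespace Matrix

open scoped Kronecker

variable {F : Type*} [Field F]

/-- An idempotent matrix is split by the inclusion of its range and the projection onto it. -/
theorem exists_splitting_of_isIdempotentElem {ι : Type*} [Fintype ι] [DecidableEq ι]
    {ε : Matrix ι ι F} (h : IsIdempotentElem ε) :
    ∃ (r : ℕ) (P : Matrix ι (Fin r) F) (Q : Matrix (Fin r) ι F), Q * P = 1 ∧ P * Q = ε := by
  set f := ε.toLin' with hf
  have hff : f ∘ₗ f = f := by rw [hf, ← toLin'_mul, h.eq]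
  let b := Module.finBasis F (LinearMap.range f)
  refine ⟨_, LinearMap.toMatrix b (Pi.basisFun F ι) (LinearMap.range f).subtype,
    LinearMap.toMatrix (Pi.basisFun F ι) b f.rangeRestrict, ?_, ?_⟩
  · rw [← LinearMap.toMatrix_comp]
    convert LinearMap.toMatrix_id b
    ext ⟨_, x, rfl⟩ : 2
    exact LinearMap.congr_fun hff x
  · rw [← LinearMap.toMatrix_comp, LinearMap.subtype_comp_codRestrict]
    exact LinearMap.toMatrix'_toLin' ε

/-- Conjugation by a pair of mutually inverse, possibly differently indexed, matrices. -/
def conjAlgEquiv {ι κ : Type*} [Fintype ι] [DecidableEq ι] [Fintype κ] [DecidableEq κ]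
    (X : Matrix κ ι F) (Y : Matrix ι κ F) (hXY : X * Y = 1) (hYX : Y * X = 1) :
    Matrix ι ι F ≃ₐ[F] Matrix κ κ F where
  toFun a := X * a * Y
  invFun a := Y * a * X
  left_inv a := by
    calc Y * (X * a * Y) * X = (Y * X) * a * (Y * X) := by simp only [Matrix.mul_assoc]
      _ = a := by rw [hYX, Matrix.one_mul, Matrix.mul_one]
  right_inv a := by
    calc X * (Y * a * X) * Y = (X * Y) * a * (X * Y) := by simp only [Matrix.mul_assoc]
      _ = a := by rw [hXY, Matrix.one_mul, Matrix.mul_one]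
  map_mul' a b := by
    calc X * (a * b) * Y = X * a * (1 : Matrix ι ι F) * b * Y := by
          simp only [Matrix.mul_assoc, Matrix.one_mul]
      _ = X * a * Y * (X * b * Y) := by rw [← hYX]; simp only [Matrix.mul_assoc]
  map_add' a b := by rw [Matrix.mul_add, Matrix.add_mul]
  commutes' c := by
    rw [Algebra.algebraMap_eq_smul_one, Algebra.algebraMap_eq_smul_one, Matrix.mul_smul,
      Matrix.smul_mul, Matrix.mul_one, hXY]

/-- The homomorphism `a ↦ a ⊗ 1`, which repeats a matrix along the diagonal. -/
def repeatAlgHom (F : Type*) [Field F] (ι κ : Type*) [Fintype ι] [DecidableEq ι] [Fintype κ]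
    [DecidableEq κ] : Matrix ι ι F →ₐ[F] Matrix (ι × κ) (ι × κ) F where
  toFun a := a ⊗ₖ 1
  map_one' := one_kronecker_one
  map_mul' a b := by rw [← mul_kronecker_mul, Matrix.one_mul]
  map_zero' := zero_kronecker _
  map_add' a b := add_kronecker _ _ _
  commutes' c := by
    rw [Algebra.algebraMap_eq_smul_one, Algebra.algebraMap_eq_smul_one, smul_kronecker,
      one_kronecker_one]

theorem repeatAlgHom_apply {ι κ : Type*} [Fintype ι] [DecidableEq ι] [Fintype κ]
    [DecidableEq κ] (a : Matrix ι ι F) : repeatAlgHom F ι κ a = a ⊗ₖ 1 := rfl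

/-- The Skolem-Noether theorem for homomorphisms between split matrix algebras: up to
conjugation, every such homomorphism repeats a matrix along the diagonal. -/
theorem exists_eq_conj_repeat {ι κ : Type*} [Fintype ι] [DecidableEq ι] [Nonempty ι] [Fintype κ]
    [DecidableEq κ] (φ : Matrix ι ι F →ₐ[F] Matrix κ κ F) :
    ∃ (k : ℕ) (e : Matrix (ι × Fin k) (ι × Fin k) F ≃ₐ[F] Matrix κ κ F),
      Fintype.card κ = Fintype.card ι * k ∧ φ = e.toAlgHom.comp (repeatAlgHom F ι (Fin k)) := by
  obtain ⟨o⟩ := ‹Nonempty ι›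
  -- The multiplicity `k` is the rank of the image of the matrix unit `E_oo`.
  let u (i j : ι) : Matrix κ κ F := φ (single i j 1)
  have hu (i j k l : ι) : u i j * u k l = if j = k then u i l else 0 := by
    simp only [u, ← map_mul]
    split_ifs with hjk
    · subst hjk; simp
    · simp [single_mul_single_of_ne _ _ _ _ hjk]
  have hu1 : ∑ i, u i i = 1 := by
    rw [← map_sum, sum_single_eq_diagonal]; simp
  have hφ (a : Matrix ι ι F) : φ a = ∑ i, ∑ j, a i j • u i j := by
    conv_lhs => rw [matrix_eq_sum_single a]
    simp only [u, map_sum, ← map_smul, smul_single, smul_eq_mul, mul_one]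
  obtain ⟨k, P, Q, hQP, hPQ⟩ := exists_splitting_of_isIdempotentElem
    (show IsIdempotentElem (u o o) by simp [IsIdempotentElem, hu])
  -- Splitting `φ E_oo = P * Q` gives the columns `φ E_io * P` and the rows `Q * φ E_oi` of the
  -- conjugating matrices.
  let X : Matrix κ (ι × Fin k) F := of fun x p => (u p.1 o * P) x p.2
  let Y : Matrix (ι × Fin k) κ F := of fun p x => (Q * u o p.1) p.2 x
  have hYX : Y * X = 1 := by
    ext ⟨i, s⟩ ⟨j, t⟩
    have : (Y * X) (i, s) (j, t) = (Q * u o i * (u j o * P)) s t := rfl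
    rw [this, Matrix.mul_assoc, ← Matrix.mul_assoc (u o i), hu]
    split_ifs with hij
    · subst hij
      rw [← hPQ, Matrix.mul_assoc, hQP, Matrix.mul_one, hQP]
      simp [one_apply]
    · simp [hij]
  have hXaY (a : Matrix ι ι F) : X * (a ⊗ₖ (1 : Matrix (Fin k) (Fin k) F)) * Y = φ a := by
    ext x y
    have h1 (j : ι) (t : Fin k) : (X * (a ⊗ₖ (1 : Matrix (Fin k) (Fin k) F))) x (j, t)
        = ∑ i, a i j * (u i o * P) x t := by
      rw [mul_apply, Fintype.sum_prod_type]
      refine Finset.sum_congr rfl fun i _ => ?_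
      simp [X, one_apply, mul_comm]
    have h2 (i j : ι) : u i j x y = ∑ t, (u i o * P) x t * (Q * u o j) t y := by
      rw [← mul_apply, Matrix.mul_assoc, ← Matrix.mul_assoc P, hPQ, hu, if_pos rfl, hu, if_pos rfl]
    have h3 : φ a x y = ∑ i, ∑ j, a i j * u i j x y := by
      rw [hφ]
      simp only [sum_apply, smul_apply, smul_eq_mul]
    rw [mul_apply, Fintype.sum_prod_type, h3.trans Finset.sum_comm]
    refine Finset.sum_congr rfl fun j _ => ?_
    simp_rw [h1, h2, Finset.sum_mul, Finset.mul_sum]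
    rw [Finset.sum_comm]
    exact Finset.sum_congr rfl fun i _ => Finset.sum_congr rfl fun t _ => mul_assoc _ _ _
  have hXY : X * Y = 1 := by
    have := hXaY 1
    rwa [one_kronecker_one, Matrix.mul_one, map_one] at this
  refine ⟨k, conjAlgEquiv X Y hXY hYX, ?_, ?_⟩
  · rw [square_of_invertible X Y hXY hYX, Fintype.card_prod, Fintype.card_fin]
  · ext1 a
    exact (hXaY a).symm

end Matrix

/-! ### Matrix subalgebras of locally matrix algebras -/

section LocallyMatrix

variable {F : Type v} [Field F] {A : Type u} [Ring A] [Algebra F A]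

theorem Matrix.algHom_injective {ι : Type*} [Fintype ι] [DecidableEq ι] [Nontrivial A]
    (φ : Matrix ι ι F →ₐ[F] A) : Function.Injective φ := by
  cases isEmpty_or_nonempty ι
  · exact Function.injective_of_subsingleton _
  · exact φ.toRingHom.injective

theorem Matrix.nonempty_of_algHom {ι : Type*} [Fintype ι] [DecidableEq ι] [Nontrivial A]
    (φ : Matrix ι ι F →ₐ[F] A) : Nonempty ι := by
  by_contra h
  rw [not_nonempty_iff] at h
  have := congrArg φ (Subsingleton.elim (0 : Matrix ι ι F) 1)
  simp at this

/-- A homomorphism from a matrix algebra reindexed along an equality of sizes. -/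
noncomputable def Matrix.reindexAlgHom {ι κ : Type*} [Fintype ι] [DecidableEq ι] [Fintype κ]
    [DecidableEq κ] (h : Fintype.card ι = Fintype.card κ) (φ : Matrix ι ι F →ₐ[F] A) :
    Matrix κ κ F →ₐ[F] A :=
  φ.comp (Matrix.reindexAlgEquiv F F (Fintype.equivOfCardEq h.symm)).toAlgHom

theorem Matrix.range_reindexAlgHom {ι κ : Type*} [Fintype ι] [DecidableEq ι] [Fintype κ]
    [DecidableEq κ] (h : Fintype.card ι = Fintype.card κ) (φ : Matrix ι ι F →ₐ[F] A) :
    (Matrix.reindexAlgHom h φ).range = φ.range := by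
  apply le_antisymm
  · rintro _ ⟨x, rfl⟩
    exact ⟨_, rfl⟩
  · rintro _ ⟨x, rfl⟩
    refine ⟨(Matrix.reindexAlgEquiv F F (Fintype.equivOfCardEq h.symm)).symm x, ?_⟩
    simp [Matrix.reindexAlgHom]

theorem mem_matrixDegrees_iff [Nontrivial A] {n : ℕ+} :
    n ∈ matrixDegrees F A ↔ Nonempty (Matrix (Fin n) (Fin n) F →ₐ[F] A) := by
  constructor
  · rintro ⟨B, ⟨e⟩⟩
    exact ⟨B.val.comp e.symm.toAlgHom⟩
  · rintro ⟨φ⟩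
    exact ⟨φ.range, ⟨(AlgEquiv.ofInjective φ (Matrix.algHom_injective φ)).symm⟩⟩

theorem mem_matrixDegrees_of_algHom [Nontrivial A] {ι : Type*} [Fintype ι] [DecidableEq ι]
    (φ : Matrix ι ι F →ₐ[F] A) {n : ℕ+} (hn : Fintype.card ι = n) :
    n ∈ matrixDegrees F A :=
  mem_matrixDegrees_iff.2 ⟨Matrix.reindexAlgHom (by simpa using hn) φ⟩

theorem mem_matrixDegrees_of_dvd [Nontrivial A] {m n : ℕ+} (hmn : m ∣ n)
    (hn : n ∈ matrixDegrees F A) : m ∈ matrixDegrees F A := by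
  obtain ⟨k, rfl⟩ := hmn
  obtain ⟨φ⟩ := mem_matrixDegrees_iff.1 hn
  have hcard : Fintype.card (Fin ↑(m * k)) = Fintype.card (Fin m × Fin k) := by
    rw [Fintype.card_prod, Fintype.card_fin, Fintype.card_fin, Fintype.card_fin, PNat.mul_coe]
  exact mem_matrixDegrees_iff.2
    ⟨(Matrix.reindexAlgHom hcard φ).comp (Matrix.repeatAlgHom F (Fin m) (Fin k))⟩

theorem le_exponent_steinitzNumber {n : ℕ+} (hn : n ∈ matrixDegrees F A) (p : Nat.Primes) :
    ((n : ℕ).factorization p : ℕ∞) ≤ (steinitzNumber F A).exponent p :=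
  le_iSup₂_of_le (f := fun (n : ℕ+) (_ : n ∈ matrixDegrees F A) =>
    (SteinitzNumber.ofPNat n).exponent p) n hn le_rfl

theorem exponent_steinitzNumber_le {p : Nat.Primes} {x : ℕ∞}
    (h : ∀ n ∈ matrixDegrees F A, ((n : ℕ).factorization p : ℕ∞) ≤ x) :
    (steinitzNumber F A).exponent p ≤ x :=
  iSup₂_le h

namespace IsLocallyMatrixAlgebra

theorem nontrivial (h : IsLocallyMatrixAlgebra F A) : Nontrivial A := by
  obtain ⟨B, n, -, ⟨e⟩⟩ := h ∅
  have : Nontrivial B := e.toEquiv.nontrivial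
  exact (Subtype.val_injective (p := (· ∈ B))).nontrivial

theorem exists_algHom (h : IsLocallyMatrixAlgebra F A) (S : Finset A) :
    ∃ (n : ℕ) (ψ : Matrix (Fin n) (Fin n) F →ₐ[F] A), (S : Set A) ⊆ ψ.range := by
  obtain ⟨B, n, hS, ⟨e⟩⟩ := h S
  refine ⟨n, B.val.comp e.symm.toAlgHom, fun x hx => ⟨e ⟨x, hS hx⟩, ?_⟩⟩
  simp

theorem of_exists_algHom [Nontrivial A] (h : ∀ S : Finset A, ∃ (n : ℕ)
    (ψ : Matrix (Fin n) (Fin n) F →ₐ[F] A), (S : Set A) ⊆ ψ.range) :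
    IsLocallyMatrixAlgebra F A := by
  intro S
  obtain ⟨n, ψ, hS⟩ := h S
  have hn : 0 < n := Fin.pos_iff_nonempty.2 (Matrix.nonempty_of_algHom ψ)
  exact ⟨ψ.range, ⟨n, hn⟩, hS,
    ⟨(AlgEquiv.ofInjective ψ (Matrix.algHom_injective ψ)).symm⟩⟩

end IsLocallyMatrixAlgebra

/-- Whether a homomorphism from a finite-dimensional algebra factors through a given matrix
subalgebra can be tested on finitely many elements. -/
theorem AlgHom.exists_finset_forall_factor [Nontrivial A] {M : Type*} [Ring M] [Algebra F M]
    [Module.Finite F M] (φ : M →ₐ[F] A) :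
    ∃ S : Finset A, ∀ {n : ℕ} (ψ : Matrix (Fin n) (Fin n) F →ₐ[F] A),
      (S : Set A) ⊆ ψ.range → ∃ φ' : M →ₐ[F] Matrix (Fin n) (Fin n) F, φ = ψ.comp φ' := by
  classical
  obtain ⟨T, hT⟩ := Module.Finite.fg_top (R := F) (M := M)
  refine ⟨T.image φ, fun {n} ψ hψ => ?_⟩
  rw [Finset.coe_image] at hψ
  have hφ (x : M) : φ x ∈ ψ.range := by
    have hle : Submodule.span F (T : Set M) ≤
        (Subalgebra.toSubmodule ψ.range).comap φ.toLinearMap :=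
      Submodule.span_le.2 fun x hx => hψ ⟨x, hx, rfl⟩
    rw [hT] at hle
    exact hle Submodule.mem_top
  let e := AlgEquiv.ofInjective ψ (Matrix.algHom_injective ψ)
  refine ⟨e.symm.toAlgHom.comp (φ.codRestrict ψ.range hφ), ?_⟩
  ext x
  exact (congrArg Subtype.val (e.apply_symm_apply ⟨φ x, hφ x⟩)).symm

namespace IsLocallyMatrixAlgebra

theorem exists_algHom_factor (h : IsLocallyMatrixAlgebra F A) (S : Finset A)
    {M : Type*} [Ring M] [Algebra F M] [Module.Finite F M] (φ : M →ₐ[F] A) :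
    ∃ (n : ℕ) (ψ : Matrix (Fin n) (Fin n) F →ₐ[F] A) (φ' : M →ₐ[F] Matrix (Fin n) (Fin n) F),
      (S : Set A) ⊆ ψ.range ∧ φ = ψ.comp φ' := by
  classical
  have := h.nontrivial
  obtain ⟨T, hT⟩ := φ.exists_finset_forall_factor
  obtain ⟨n, ψ, hψ⟩ := h.exists_algHom (S ∪ T)
  rw [Finset.coe_union, Set.union_subset_iff] at hψ
  obtain ⟨φ', hφ'⟩ := hT ψ hψ.2
  exact ⟨n, ψ, φ', hψ.1, hφ'⟩

theorem exists_common_algHom (h : IsLocallyMatrixAlgebra F A) {M N : Type*} [Ring M]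
    [Algebra F M] [Module.Finite F M] [Ring N] [Algebra F N] [Module.Finite F N]
    (φ : M →ₐ[F] A) (χ : N →ₐ[F] A) :
    ∃ (n : ℕ) (ψ : Matrix (Fin n) (Fin n) F →ₐ[F] A) (φ' : M →ₐ[F] Matrix (Fin n) (Fin n) F)
      (χ' : N →ₐ[F] Matrix (Fin n) (Fin n) F), φ = ψ.comp φ' ∧ χ = ψ.comp χ' := by
  have := h.nontrivial
  obtain ⟨T, hT⟩ := χ.exists_finset_forall_factor
  obtain ⟨n, ψ, φ', hψ, hφ⟩ := h.exists_algHom_factor T φ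
  obtain ⟨χ', hχ⟩ := hT ψ hψ
  exact ⟨n, ψ, φ', χ', hφ, hχ⟩

theorem one_mem_matrixDegrees (h : IsLocallyMatrixAlgebra F A) : 1 ∈ matrixDegrees F A := by
  have := h.nontrivial
  obtain ⟨B, n, -, hB⟩ := h ∅
  exact mem_matrixDegrees_of_dvd (one_dvd n) ⟨B, hB⟩

theorem exists_common_multiple (h : IsLocallyMatrixAlgebra F A) {m n : ℕ+}
    (hm : m ∈ matrixDegrees F A) (hn : n ∈ matrixDegrees F A) :
    ∃ l ∈ matrixDegrees F A, m ∣ l ∧ n ∣ l := by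
  have := h.nontrivial
  obtain ⟨φ⟩ := mem_matrixDegrees_iff.1 hm
  obtain ⟨χ⟩ := mem_matrixDegrees_iff.1 hn
  obtain ⟨l, ψ, φ', χ', -, -⟩ := h.exists_common_algHom φ χ
  have hl : 0 < l := Fin.pos_iff_nonempty.2 (Matrix.nonempty_of_algHom ψ)
  obtain ⟨j, -, hj, -⟩ := Matrix.exists_eq_conj_repeat φ'
  obtain ⟨k, -, hk, -⟩ := Matrix.exists_eq_conj_repeat χ'
  simp only [Fintype.card_fin] at hj hk
  exact ⟨⟨l, hl⟩, mem_matrixDegrees_of_algHom ψ (by simp), PNat.dvd_iff.2 ⟨j, hj⟩,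
    PNat.dvd_iff.2 ⟨k, hk⟩⟩

/-- A positive integer that divides the Steinitz number is a matrix degree: every prime power in it
divides some matrix degree, and matrix degrees have common multiples. -/
theorem mem_matrixDegrees_of_le (h : IsLocallyMatrixAlgebra F A) {n : ℕ+}
    (hn : ∀ p : Nat.Primes, ((n : ℕ).factorization p : ℕ∞) ≤ (steinitzNumber F A).exponent p) :
    n ∈ matrixDegrees F A := by
  classical
  have := h.nontrivial
  have hprime (p : Nat.Primes) :
      ∃ m ∈ matrixDegrees F A, (n : ℕ).factorization p ≤ (m : ℕ).factorization p := by
    rcases Nat.eq_zero_or_pos ((n : ℕ).factorization p) with h0 | hpos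
    · exact ⟨1, h.one_mem_matrixDegrees, by simp [h0]⟩
    · have hlt : (((n : ℕ).factorization p - 1 : ℕ) : ℕ∞) < (steinitzNumber F A).exponent p :=
        lt_of_lt_of_le (by exact_mod_cast Nat.sub_lt hpos one_pos) (hn p)
      obtain ⟨m, hlt⟩ := lt_iSup_iff.1 hlt
      obtain ⟨hm, hlt⟩ := lt_iSup_iff.1 hlt
      have hlt' : (n : ℕ).factorization p - 1 < (m : ℕ).factorization p := by
        rw [SteinitzNumber.exponent_ofPNat] at hlt
        exact_mod_cast hlt
      exact ⟨m, hm, by omega⟩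
  have hfin (s : Finset Nat.Primes) :
      ∃ m ∈ matrixDegrees F A, ∀ p ∈ s, (n : ℕ).factorization p ≤ (m : ℕ).factorization p := by
    induction s using Finset.induction_on with
    | empty => exact ⟨1, h.one_mem_matrixDegrees, by simp⟩
    | insert p s _ ih =>
      obtain ⟨a, ha, hpa⟩ := hprime p
      obtain ⟨b, hb, hsb⟩ := ih
      obtain ⟨l, hl, hal, hbl⟩ := h.exists_common_multiple ha hb
      have hle {x : ℕ+} (hx : x ∣ l) (q : ℕ) : (x : ℕ).factorization q ≤ (l : ℕ).factorization q :=
        (Nat.factorization_le_iff_dvd x.ne_zero l.ne_zero).2 (PNat.dvd_iff.1 hx) q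
      refine ⟨l, hl, fun q hq => ?_⟩
      rcases Finset.mem_insert.1 hq with rfl | hq
      · exact hpa.trans (hle hal _)
      · exact (hsb q hq).trans (hle hbl _)
  obtain ⟨m, hm, hle⟩ := hfin ((n : ℕ).primeFactors.subtype Nat.Prime)
  refine mem_matrixDegrees_of_dvd (PNat.dvd_iff.2 ?_) hm
  rw [← Nat.factorization_le_iff_dvd n.ne_zero m.ne_zero]
  intro p
  by_cases hp : p ∈ (n : ℕ).primeFactors
  · exact hle ⟨p, Nat.prime_of_mem_primeFactors hp⟩
      (Finset.mem_subtype.2 hp)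
  · rw [← Nat.support_factorization, Finsupp.notMem_support_iff] at hp
    simp [hp]

end IsLocallyMatrixAlgebra
end LocallyMatrix

/-! ### Glimm's theorem -/

section Glimm

variable {F : Type v} [Field F]

/-- If `n * k` is a matrix degree of a locally matrix algebra, then every homomorphism from
matrices of size `n` extends along `a ↦ a ⊗ 1` to matrices of size `n * k`. Inside a matrix
subalgebra of degree `n * a` that contains matrices of both sizes, the given homomorphism becomes
`x ↦ x ⊗ 1_a`, where `k` divides `a`. -/
theorem IsLocallyMatrixAlgebra.exists_extension {C : Type u} [Ring C] [Algebra F C]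
    (h : IsLocallyMatrixAlgebra F C) {ι : Type*} [Fintype ι] [DecidableEq ι] {k : ℕ}
    (φ : Matrix ι ι F →ₐ[F] C) (χ : Matrix (ι × Fin k) (ι × Fin k) F →ₐ[F] C) :
    ∃ ψ : Matrix (ι × Fin k) (ι × Fin k) F →ₐ[F] C,
      ψ.comp (Matrix.repeatAlgHom F ι (Fin k)) = φ := by
  have := h.nontrivial
  have hι := Matrix.nonempty_of_algHom φ
  have hιk := Matrix.nonempty_of_algHom χ
  obtain ⟨N, ω, φ', χ', rfl, rfl⟩ := h.exists_common_algHom φ χ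
  obtain ⟨a, e, ha, rfl⟩ := Matrix.exists_eq_conj_repeat φ'
  obtain ⟨b, -, hb, -⟩ := Matrix.exists_eq_conj_repeat χ'
  have hab : a = k * b := by
    rw [ha, Fintype.card_prod, Fintype.card_fin, mul_assoc] at hb
    exact Nat.eq_of_mul_eq_mul_left Fintype.card_pos hb
  let f : Fin k × Fin b ≃ Fin a := finProdFinEquiv.trans (finCongr hab.symm)
  let g : (ι × Fin k) × Fin b ≃ ι × Fin a :=
    (Equiv.prodAssoc _ _ _).trans (Equiv.prodCongrRight fun _ => f)
  refine ⟨ω.comp (e.toAlgHom.comp ((Matrix.reindexAlgEquiv F F g).toAlgHom.comp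
    (Matrix.repeatAlgHom F (ι × Fin k) (Fin b)))), ?_⟩
  have : (Matrix.reindexAlgEquiv F F g).toAlgHom.comp
      ((Matrix.repeatAlgHom F (ι × Fin k) (Fin b)).comp (Matrix.repeatAlgHom F ι (Fin k))) =
        Matrix.repeatAlgHom F ι (Fin a) := by
    ext1 x
    ext ⟨i, s⟩ ⟨j, t⟩
    obtain ⟨s, rfl⟩ := f.surjective s
    obtain ⟨t, rfl⟩ := f.surjective t
    have hs (i : ι) (s) : g.symm (i, f s) = ((i, s.1), s.2) := by simp [g]
    simp only [Matrix.repeatAlgHom_apply, AlgHom.comp_apply, AlgEquiv.toAlgHom_apply,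
      Matrix.coe_reindexAlgEquiv, Matrix.reindex_apply, Matrix.submatrix_apply, hs,
      Matrix.kroneckerMap_apply, Matrix.one_apply, EmbeddingLike.apply_eq_iff_eq, Prod.ext_iff]
    split_ifs <;> simp_all
  rw [← this]
  rfl

/-- A finite stage of an isomorphism from `A` to `C`: a matrix subalgebra of `A × C`, viewed as
the graph of an isomorphism between its projections. -/
def IsMatrixGraph (F : Type v) [Field F] {A C : Type u} [Ring A] [Algebra F A] [Ring C]
    [Algebra F C] (G : Subalgebra F (A × C)) : Prop :=
  ∃ (n : ℕ) (φ : Matrix (Fin n) (Fin n) F →ₐ[F] A × C), G = φ.range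

variable {A C : Type u} [Ring A] [Algebra F A] [Ring C] [Algebra F C]

theorem IsMatrixGraph.injective_fst [Nontrivial A] {G : Subalgebra F (A × C)}
    (hG : IsMatrixGraph F G) {x y : A × C} (hx : x ∈ G) (hy : y ∈ G) (h : x.1 = y.1) : x = y := by
  obtain ⟨n, φ, rfl⟩ := hG
  obtain ⟨a, rfl⟩ := hx
  obtain ⟨b, rfl⟩ := hy
  exact congrArg φ (Matrix.algHom_injective ((AlgHom.fst F A C).comp φ) h)

theorem IsMatrixGraph.swap {G : Subalgebra F (A × C)} (hG : IsMatrixGraph F G) :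
    IsMatrixGraph F (G.map ((AlgHom.snd F A C).prod (AlgHom.fst F A C))) := by
  obtain ⟨n, φ, rfl⟩ := hG
  exact ⟨n, _, (AlgHom.range_comp φ _).symm⟩

/-- The step of the back-and-forth construction: a finite stage is enlarged so that its domain
contains `a`. In `A` the enlargement is found inside a large matrix subalgebra, and by
`IsLocallyMatrixAlgebra.exists_extension` it can be copied in `C`. -/
theorem IsMatrixGraph.exists_le_fst (hA : IsLocallyMatrixAlgebra F A)
    (hC : IsLocallyMatrixAlgebra F C) (hAC : matrixDegrees F A ⊆ matrixDegrees F C)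
    {G : Subalgebra F (A × C)} (hG : IsMatrixGraph F G) (a : A) :
    ∃ G', IsMatrixGraph F G' ∧ G ≤ G' ∧ ∃ x ∈ G', x.1 = a := by
  have := hA.nontrivial
  have := hC.nontrivial
  obtain ⟨n, φ, rfl⟩ := hG
  have := Matrix.nonempty_of_algHom φ
  obtain ⟨N, ω, φ', ha, hφ⟩ := hA.exists_algHom_factor {a} ((AlgHom.fst F A C).comp φ)
  obtain ⟨k, e, hk, rfl⟩ := Matrix.exists_eq_conj_repeat φ'
  have hN : 0 < N := Fin.pos_iff_nonempty.2 (Matrix.nonempty_of_algHom ω)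
  obtain ⟨χ⟩ := mem_matrixDegrees_iff.1
    (hAC (mem_matrixDegrees_of_algHom (n := ⟨N, hN⟩) ω (by simp)))
  have hcard : Fintype.card (Fin N) = Fintype.card (Fin n × Fin k) := by simpa using hk
  obtain ⟨ψ, hψ⟩ := hC.exists_extension ((AlgHom.snd F A C).comp φ)
    (Matrix.reindexAlgHom hcard χ)
  let Ψ : Matrix (Fin n × Fin k) (Fin n × Fin k) F →ₐ[F] A × C :=
    (ω.comp e.toAlgHom).prod ψ
  have hΨ : Ψ.comp (Matrix.repeatAlgHom F (Fin n) (Fin k)) = φ := by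
    ext1 x
    exact Prod.ext (AlgHom.congr_fun hφ x).symm (AlgHom.congr_fun hψ x)
  refine ⟨Ψ.range, ⟨N, Matrix.reindexAlgHom hcard.symm Ψ, ?_⟩, ?_, ?_⟩
  · exact (Matrix.range_reindexAlgHom _ _).symm
  · rw [← hΨ]
    rintro _ ⟨x, rfl⟩
    exact ⟨_, rfl⟩
  · obtain ⟨y, hy⟩ := ha (Finset.mem_singleton_self a)
    refine ⟨Ψ (e.symm y), ⟨_, rfl⟩, ?_⟩
    change ω (e (e.symm y)) = a
    rw [e.apply_symm_apply]
    exact hy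

theorem IsMatrixGraph.exists_le_snd (hA : IsLocallyMatrixAlgebra F A)
    (hC : IsLocallyMatrixAlgebra F C) (hAC : matrixDegrees F C ⊆ matrixDegrees F A)
    {G : Subalgebra F (A × C)} (hG : IsMatrixGraph F G) (c : C) :
    ∃ G', IsMatrixGraph F G' ∧ G ≤ G' ∧ ∃ x ∈ G', x.2 = c := by
  obtain ⟨G', hG', hle, x, hx, rfl⟩ := hG.swap.exists_le_fst hC hA hAC c
  refine ⟨_, hG'.swap, fun y hy => ⟨y.swap, hle ⟨y, hy, rfl⟩, rfl⟩, x.swap, ⟨x, hx, rfl⟩, rfl⟩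

theorem exists_spanning_seq_of_rank_le {V : Type u} [AddCommGroup V] [Module F V]
    (h : Module.rank F V ≤ Cardinal.aleph0) : ∃ s : ℕ → V, Submodule.span F (Set.range s) = ⊤ := by
  let b := Module.Basis.ofVectorSpace F V
  have hc : (Set.range b).Countable := by
    rw [← Cardinal.le_aleph0_iff_set_countable, Cardinal.mk_range_eq b b.injective]
    rwa [b.mk_eq_rank'']
  obtain ⟨s, hs⟩ := (hc.insert 0).exists_eq_range (Set.insert_nonempty _ _)
  exact ⟨s, by rw [← hs, Submodule.span_insert_zero, b.span_eq]⟩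

/-- **Glimm's theorem**: locally matrix algebras of at most countable dimension are determined up
to isomorphism by their Steinitz numbers. -/
theorem IsCountableLocallyMatrixAlgebra.nonempty_algEquiv
    (hA : IsCountableLocallyMatrixAlgebra F A) (hC : IsCountableLocallyMatrixAlgebra F C)
    (h : steinitzNumber F A = steinitzNumber F C) : Nonempty (A ≃ₐ[F] C) := by
  have := hA.1.nontrivial
  have := hC.1.nontrivial
  have hAC : matrixDegrees F A ⊆ matrixDegrees F C := fun n hn =>
    hC.1.mem_matrixDegrees_of_le fun p => h ▸ le_exponent_steinitzNumber hn p
  have hCA : matrixDegrees F C ⊆ matrixDegrees F A := fun n hn =>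
    hA.1.mem_matrixDegrees_of_le fun p => h ▸ le_exponent_steinitzNumber hn p
  obtain ⟨a, ha⟩ := exists_spanning_seq_of_rank_le hA.2
  obtain ⟨c, hc⟩ := exists_spanning_seq_of_rank_le hC.2
  -- An ideal of the order of finite stages that is generic for the conditions that the domain
  -- contains `a m` and that the range contains `c m` has the graph of an isomorphism as its union.
  let P := {G : Subalgebra F (A × C) // IsMatrixGraph F G}
  let D : ℕ ⊕ ℕ → Order.Cofinal P := Sum.elim
    (fun m => ⟨{G | ∃ x ∈ G.1, x.1 = a m}, fun G => by
      obtain ⟨G', hG', hle, hx⟩ := G.2.exists_le_fst hA.1 hC.1 hAC (a m)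
      exact ⟨⟨G', hG'⟩, hx, hle⟩⟩)
    (fun m => ⟨{G | ∃ x ∈ G.1, x.2 = c m}, fun G => by
      obtain ⟨G', hG', hle, hx⟩ := G.2.exists_le_snd hA.1 hC.1 hCA (c m)
      exact ⟨⟨G', hG'⟩, hx, hle⟩⟩)
  obtain ⟨φ⟩ := mem_matrixDegrees_iff.1 hA.1.one_mem_matrixDegrees
  obtain ⟨χ⟩ := mem_matrixDegrees_iff.1 hC.1.one_mem_matrixDegrees
  let G₀ : P := ⟨(φ.prod χ).range, _, φ.prod χ, rfl⟩
  let I := Order.idealOfCofinals G₀ D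
  have hdir : Directed (· ≤ ·) fun G : I => G.1.1 := by
    rintro ⟨G, hG⟩ ⟨H, hH⟩
    obtain ⟨K, hK, h1, h2⟩ := I.directed G hG H hH
    exact ⟨⟨K, hK⟩, h1, h2⟩
  have : Nonempty I := ⟨⟨G₀, Order.mem_idealOfCofinals _ _⟩⟩
  let U : Subalgebra F (A × C) := ⨆ G : I, G.1.1
  have hU {x : A × C} : x ∈ U ↔ ∃ G : I, x ∈ G.1.1 := by
    rw [← SetLike.mem_coe, Subalgebra.coe_iSup_of_directed hdir, Set.mem_iUnion]
    rfl
  have hU₂ {x y : A × C} (hx : x ∈ U) (hy : y ∈ U) : ∃ G, IsMatrixGraph F G ∧ x ∈ G ∧ y ∈ G := by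
    obtain ⟨G, hx⟩ := hU.1 hx
    obtain ⟨H, hy⟩ := hU.1 hy
    obtain ⟨K, h1, h2⟩ := hdir G H
    exact ⟨K.1.1, K.1.2, h1 hx, h2 hy⟩
  have h1 : Function.Bijective ((AlgHom.fst F A C).comp U.val) := by
    constructor
    · rintro ⟨x, hx⟩ ⟨y, hy⟩ hxy
      obtain ⟨G, hG, hx, hy⟩ := hU₂ hx hy
      exact Subtype.ext (hG.injective_fst hx hy hxy)
    · rw [← LinearMap.coe_coe, ← LinearMap.range_eq_top, eq_top_iff, ← ha, Submodule.span_le]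
      rintro _ ⟨m, rfl⟩
      obtain ⟨G, ⟨x, hx, hxa⟩, hG⟩ := Order.cofinal_meets_idealOfCofinals G₀ D (Sum.inl m)
      exact ⟨⟨x, hU.2 ⟨⟨G, hG⟩, hx⟩⟩, hxa⟩
  have h2 : Function.Bijective ((AlgHom.snd F A C).comp U.val) := by
    constructor
    · rintro ⟨x, hx⟩ ⟨y, hy⟩ hxy
      obtain ⟨G, hG, hx, hy⟩ := hU₂ hx hy
      have := hG.swap.injective_fst (x := x.swap) (y := y.swap) ⟨x, hx, rfl⟩ ⟨y, hy, rfl⟩ hxy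
      exact Subtype.ext (Prod.swap_injective this)
    · rw [← LinearMap.coe_coe, ← LinearMap.range_eq_top, eq_top_iff, ← hc, Submodule.span_le]
      rintro _ ⟨m, rfl⟩
      obtain ⟨G, ⟨x, hx, hxa⟩, hG⟩ := Order.cofinal_meets_idealOfCofinals G₀ D (Sum.inr m)
      exact ⟨⟨x, hU.2 ⟨⟨G, hG⟩, hx⟩⟩, hxa⟩
  exact ⟨(AlgEquiv.ofBijective _ h1).symm.trans (AlgEquiv.ofBijective _ h2)⟩

end Glimm

/-! ### Steinitz numbers of corners and of matrix algebras -/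

section Corner

open scoped Kronecker

variable {F : Type v} [Field F] {A : Type u} [Ring A] [Algebra F A]

/-- If `e` is the image of an idempotent matrix `P * Q` with `Q * P = 1`, then `g ↦ P * g * Q`
embeds the matrices of the size of `Q * P` into the corner `e A e`. -/
noncomputable def cornerAlgHom {ι κ : Type*} [Fintype ι] [DecidableEq ι] [Fintype κ] [DecidableEq κ]
    (ψ : Matrix ι ι F →ₐ[F] A) {P : Matrix ι κ F} {Q : Matrix κ ι F} (hQP : Q * P = 1) {e : A}
    (he : IsIdempotentElem e) (hψ : ψ (P * Q) = e) : Matrix κ κ F →ₐ[F] he.Corner where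
  toFun g := ⟨ψ (P * g * Q), (Subsemigroup.mem_corner_iff he).2 ⟨by
    rw [← hψ, ← map_mul, show P * Q * (P * g * Q) = P * (Q * P) * g * Q by
      simp only [Matrix.mul_assoc], hQP, Matrix.mul_one], by
    rw [← hψ, ← map_mul, show P * g * Q * (P * Q) = P * g * (Q * P) * Q by
      simp only [Matrix.mul_assoc], hQP, Matrix.mul_one]⟩⟩
  map_one' := Subtype.ext (by
    change ψ (P * 1 * Q) = e
    rw [Matrix.mul_one, hψ])
  map_mul' g g' := Subtype.ext (by
    change ψ _ = ψ _ * ψ _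
    rw [← map_mul, show P * g * Q * (P * g' * Q) = P * g * (Q * P) * g' * Q by
      simp only [Matrix.mul_assoc], hQP, Matrix.mul_one, Matrix.mul_assoc P g])
  map_zero' := Subtype.ext (by
    change ψ (P * 0 * Q) = 0
    rw [Matrix.mul_zero, Matrix.zero_mul, map_zero])
  map_add' g g' := Subtype.ext (by
    change ψ (P * (g + g') * Q) = ψ (P * g * Q) + ψ (P * g' * Q)
    rw [Matrix.mul_add, Matrix.add_mul, map_add])
  commutes' c := Subtype.ext (by
    change ψ (P * algebraMap F _ c * Q) = c • e
    rw [Algebra.algebraMap_eq_smul_one, Matrix.mul_smul, Matrix.smul_mul, map_smul,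
      Matrix.mul_one, hψ])

theorem mem_range_cornerAlgHom {ι κ : Type*} [Fintype ι] [DecidableEq ι] [Fintype κ]
    [DecidableEq κ] (ψ : Matrix ι ι F →ₐ[F] A) {P : Matrix ι κ F} {Q : Matrix κ ι F}
    (hQP : Q * P = 1) {e : A} (he : IsIdempotentElem e) (hψ : ψ (P * Q) = e) {x : he.Corner}
    (hx : x.1 ∈ ψ.range) : x ∈ (cornerAlgHom ψ hQP he hψ).range := by
  obtain ⟨y, hy⟩ := hx
  refine ⟨Q * y * P, Subtype.ext ?_⟩
  have hy' : ψ y = x.1 := hy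
  obtain ⟨h1, h2⟩ := (Subsemigroup.mem_corner_iff he).1 x.2
  calc ψ (P * (Q * y * P) * Q) = ψ (P * Q * y * (P * Q)) := by simp only [Matrix.mul_assoc]
    _ = x.1 := by rw [map_mul, map_mul, hψ, hy', h1, h2]

theorem IsIdempotentElem.nontrivial_corner {e : A} (he : IsIdempotentElem e) (h0 : e ≠ 0) :
    Nontrivial he.Corner :=
  ⟨⟨1, 0, fun h => h0 (congrArg Subtype.val h)⟩⟩

namespace IsLocallyMatrixAlgebra

/-- An idempotent of a locally matrix algebra is a split idempotent matrix in some matrix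
subalgebra, which may be taken to contain a given finite set. -/
theorem exists_splitting (h : IsLocallyMatrixAlgebra F A) {e : A} (he : IsIdempotentElem e)
    (S : Finset A) : ∃ (n r : ℕ) (ψ : Matrix (Fin n) (Fin n) F →ₐ[F] A)
      (P : Matrix (Fin n) (Fin r) F) (Q : Matrix (Fin r) (Fin n) F),
      (S : Set A) ⊆ ψ.range ∧ Q * P = 1 ∧ ψ (P * Q) = e := by
  classical
  have := h.nontrivial
  obtain ⟨n, ψ, hψ⟩ := h.exists_algHom (insert e S)
  rw [Finset.coe_insert, Set.insert_subset_iff] at hψ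
  obtain ⟨⟨ε, hε⟩, hS⟩ := hψ
  have hε' : ψ ε = e := hε
  have hεε : IsIdempotentElem ε := by
    apply Matrix.algHom_injective ψ
    rw [map_mul, hε', he.eq]
  obtain ⟨r, P, Q, hQP, rfl⟩ := Matrix.exists_splitting_of_isIdempotentElem hεε
  exact ⟨n, r, ψ, P, Q, hS, hQP, hε'⟩

theorem corner (h : IsLocallyMatrixAlgebra F A) {e : A} (he : IsIdempotentElem e) (h0 : e ≠ 0) :
    IsLocallyMatrixAlgebra F he.Corner := by
  classical
  have := he.nontrivial_corner h0
  refine of_exists_algHom fun S => ?_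
  obtain ⟨n, r, ψ, P, Q, hS, hQP, hψ⟩ := h.exists_splitting he (S.image Subtype.val)
  refine ⟨r, cornerAlgHom ψ hQP he hψ, fun x hx => mem_range_cornerAlgHom ψ hQP he hψ (hS ?_)⟩
  exact Finset.mem_image_of_mem _ hx

/-- To bound a translate of an exponent of the Steinitz number, it suffices to bound the
translates of the exponents of the matrix degrees; there is at least one of them. -/
theorem add_exponent_le (h : IsLocallyMatrixAlgebra F A) {p : Nat.Primes} {a : ℕ} {x : ℕ∞}
    (hx : ∀ n ∈ matrixDegrees F A, (a : ℕ∞) + ((n : ℕ).factorization p : ℕ∞) ≤ x) :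
    (a : ℕ∞) + (steinitzNumber F A).exponent p ≤ x := by
  change (a : ℕ∞) + (⨆ n ∈ matrixDegrees F A, _) ≤ x
  rw [ENat.add_biSup ⟨1, h.one_mem_matrixDegrees⟩]
  exact iSup₂_le hx

/-- A corner cut out by an idempotent of rank `r` in a unital matrix subalgebra of degree `n`
has the Steinitz number `r / n` times that of the whole algebra. -/
theorem steinitzNumber_corner (h : IsLocallyMatrixAlgebra F A) {e : A} (he : IsIdempotentElem e)
    {n r : ℕ+} (ψ : Matrix (Fin n) (Fin n) F →ₐ[F] A) {P : Matrix (Fin n) (Fin r) F}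
    {Q : Matrix (Fin r) (Fin n) F} (hQP : Q * P = 1) (hψ : ψ (P * Q) = e) :
    SteinitzNumber.ofPNat n * steinitzNumber F he.Corner =
      SteinitzNumber.ofPNat r * steinitzNumber F A := by
  have := h.nontrivial
  have h0 : e ≠ 0 := by
    rintro rfl
    have hPQ : P * Q = 0 := Matrix.algHom_injective ψ (by rw [hψ, map_zero])
    have h1 : (1 : Matrix (Fin r) (Fin r) F) = 0 := by
      rw [← hQP, ← Matrix.mul_one (Q * P), ← hQP, Matrix.mul_assoc, ← Matrix.mul_assoc P, hPQ,
        Matrix.zero_mul, Matrix.mul_zero]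
    exact one_ne_zero h1
  have := he.nontrivial_corner h0
  have hcor := h.corner he h0
  -- A matrix subalgebra of degree `n * k` that contains the given one meets the corner in a
  -- matrix algebra of degree `r * k`.
  have key {N : ℕ} (ω : Matrix (Fin N) (Fin N) F →ₐ[F] A)
      (φ : Matrix (Fin n) (Fin n) F →ₐ[F] Matrix (Fin N) (Fin N) F) (hφ : ψ = ω.comp φ) :
      ∃ (k : ℕ+) (χ : Matrix (Fin r × Fin k) (Fin r × Fin k) F →ₐ[F] he.Corner), N = n * k ∧
        ∀ x : he.Corner, x.1 ∈ ω.range → x ∈ χ.range := by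
    obtain ⟨k, f, hk, rfl⟩ := Matrix.exists_eq_conj_repeat φ
    simp only [Fintype.card_fin] at hk
    have hN : 0 < N := Fin.pos_iff_nonempty.2 (Matrix.nonempty_of_algHom ω)
    have hk0 : 0 < k := Nat.pos_of_ne_zero fun h0 => by simp [h0] at hk; omega
    have hQP' : (Q ⊗ₖ (1 : Matrix (Fin k) (Fin k) F)) * (P ⊗ₖ (1 : Matrix (Fin k) (Fin k) F)) =
        1 := by
      rw [← Matrix.mul_kronecker_mul, hQP, Matrix.one_mul, Matrix.one_kronecker_one]
    have hψ' : (ω.comp f.toAlgHom) ((P ⊗ₖ (1 : Matrix (Fin k) (Fin k) F)) *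
        (Q ⊗ₖ (1 : Matrix (Fin k) (Fin k) F))) = e := by
      rw [← Matrix.mul_kronecker_mul, Matrix.one_mul, ← hψ, hφ]
      rfl
    refine ⟨⟨k, hk0⟩, cornerAlgHom _ hQP' he hψ', hk, fun x hx => ?_⟩
    refine mem_range_cornerAlgHom _ hQP' he hψ' ?_
    obtain ⟨y, hy⟩ := hx
    refine ⟨f.symm y, ?_⟩
    change ω (f (f.symm y)) = _
    rw [f.apply_symm_apply]
    exact hy
  ext p
  rw [SteinitzNumber.exponent_mul, SteinitzNumber.exponent_mul, SteinitzNumber.exponent_ofPNat,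
    SteinitzNumber.exponent_ofPNat]
  have hfac {a b c d : ℕ+} (h : a * b = c * d) : (a : ℕ).factorization p +
      (b : ℕ).factorization p = (c : ℕ).factorization p + (d : ℕ).factorization p := by
    rw [← Finsupp.add_apply, ← Finsupp.add_apply,
      ← Nat.factorization_mul a.ne_zero b.ne_zero, ← Nat.factorization_mul c.ne_zero d.ne_zero,
      ← PNat.mul_coe, ← PNat.mul_coe, h]
  have hle {x y : ℕ+} (hxy : x ∣ y) : (x : ℕ).factorization p ≤ (y : ℕ).factorization p :=
    (Nat.factorization_le_iff_dvd x.ne_zero y.ne_zero).2 (PNat.dvd_iff.1 hxy) p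
  apply le_antisymm
  · refine hcor.add_exponent_le fun m hm => ?_
    classical
    obtain ⟨φ⟩ := mem_matrixDegrees_iff.1 hm
    obtain ⟨S, hS⟩ := φ.exists_finset_forall_factor
    obtain ⟨N, ω, ψ', hω, hψ'⟩ := h.exists_algHom_factor (S.image Subtype.val) ψ
    obtain ⟨k, χ, hN, hχ⟩ := key ω ψ' hψ'
    have hcard : Fintype.card (Fin r × Fin k) = Fintype.card (Fin (r * k)) := by simp
    obtain ⟨φ', -⟩ := hS (Matrix.reindexAlgHom hcard χ) fun x hx => by
      rw [Matrix.range_reindexAlgHom]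
      exact hχ x (hω (Finset.mem_image_of_mem _ hx))
    obtain ⟨j, -, hj, -⟩ := Matrix.exists_eq_conj_repeat φ'
    simp only [Fintype.card_fin] at hj
    have hdvd : m ∣ r * k := PNat.dvd_iff.2 ⟨j, by rw [PNat.mul_coe, hj]⟩
    have hmem : n * k ∈ matrixDegrees F A := mem_matrixDegrees_of_algHom ω (by simp [hN])
    refine le_trans ?_ (add_le_add_right (le_exponent_steinitzNumber hmem p) _)
    have h1 := hle hdvd
    have h2 := hfac (show n * (r * k) = r * (n * k) from mul_left_comm _ _ _)
    exact_mod_cast (by omega)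
  · refine h.add_exponent_le fun m hm => ?_
    obtain ⟨φ⟩ := mem_matrixDegrees_iff.1 hm
    obtain ⟨N, ω, ψ', φ', hψ', hφ'⟩ := h.exists_common_algHom ψ φ
    obtain ⟨k, χ, hN, -⟩ := key ω ψ' hψ'
    obtain ⟨j, -, hj, -⟩ := Matrix.exists_eq_conj_repeat φ'
    simp only [Fintype.card_fin] at hj
    have hdvd : m ∣ n * k := PNat.dvd_iff.2 ⟨j, by rw [PNat.mul_coe, ← hN, hj]⟩
    have hmem : r * k ∈ matrixDegrees F he.Corner := mem_matrixDegrees_of_algHom χ (by simp)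
    refine le_trans ?_ (add_le_add_right (le_exponent_steinitzNumber hmem p) _)
    have h1 := hle hdvd
    have h2 := hfac (show n * (r * k) = r * (n * k) from mul_left_comm _ _ _)
    exact_mod_cast (by omega)

/-- Finitely many matrices over `A` have their entries in a common matrix subalgebra of `A`. -/
theorem exists_algHom_matrix (h : IsLocallyMatrixAlgebra F A) {k : ℕ} (hk : 0 < k)
    (S : Finset (Matrix (Fin k) (Fin k) A)) :
    ∃ n ∈ matrixDegrees F A, ∃ ψ : Matrix (Fin (k * n)) (Fin (k * n)) F →ₐ[F]
      Matrix (Fin k) (Fin k) A, (S : Set (Matrix (Fin k) (Fin k) A)) ⊆ ψ.range := by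
  classical
  have := h.nontrivial
  have : NeZero k := ⟨hk.ne'⟩
  obtain ⟨n, ψ, hψ⟩ := h.exists_algHom
    (S.biUnion fun x => Finset.univ.image fun ij : Fin k × Fin k => x ij.1 ij.2)
  have hn : 0 < n := Fin.pos_iff_nonempty.2 (Matrix.nonempty_of_algHom ψ)
  have hcard : Fintype.card (Fin k × Fin n) = Fintype.card (Fin (k * n)) := by simp
  let ω := (ψ.mapMatrix (m := Fin k)).comp
    (Matrix.compAlgEquiv (Fin k) (Fin n) F F).symm.toAlgHom
  refine ⟨⟨n, hn⟩, mem_matrixDegrees_of_algHom ψ (by simp), Matrix.reindexAlgHom hcard ω,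
    fun x hx => (SetLike.ext_iff.1 (Matrix.range_reindexAlgHom hcard ω) x).2 ?_⟩
  have hx' (i j : Fin k) : ∃ y, ψ y = x i j := hψ (Finset.mem_biUnion.2
    ⟨x, hx, Finset.mem_image.2 ⟨(i, j), Finset.mem_univ _, rfl⟩⟩)
  choose y hy using hx'
  refine ⟨Matrix.compAlgEquiv (Fin k) (Fin n) F F (Matrix.of y), ?_⟩
  ext i j
  exact hy i j

theorem matrix (h : IsLocallyMatrixAlgebra F A) {k : ℕ} (hk : 0 < k) :
    IsLocallyMatrixAlgebra F (Matrix (Fin k) (Fin k) A) := by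
  have := h.nontrivial
  have : NeZero k := ⟨hk.ne'⟩
  refine of_exists_algHom fun S => ?_
  obtain ⟨n, -, ψ, hψ⟩ := h.exists_algHom_matrix hk S
  exact ⟨_, ψ, hψ⟩

/-- The Steinitz number of the matrices of size `k` over `A` is `k` times that of `A`. -/
theorem steinitzNumber_matrix (h : IsLocallyMatrixAlgebra F A) (k : ℕ+) :
    steinitzNumber F (Matrix (Fin k) (Fin k) A) =
      SteinitzNumber.ofPNat k * steinitzNumber F A := by
  have := h.nontrivial
  have hM := h.matrix k.pos
  have := hM.nontrivial
  ext p
  rw [SteinitzNumber.exponent_mul, SteinitzNumber.exponent_ofPNat]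
  have hfac (n : ℕ+) : ((k * n : ℕ+) : ℕ).factorization p =
      (k : ℕ).factorization p + (n : ℕ).factorization p := by
    rw [PNat.mul_coe, Nat.factorization_mul k.ne_zero n.ne_zero, Finsupp.add_apply]
  apply le_antisymm
  · refine exponent_steinitzNumber_le fun m hm => ?_
    obtain ⟨φ⟩ := mem_matrixDegrees_iff.1 hm
    obtain ⟨S, hS⟩ := φ.exists_finset_forall_factor
    obtain ⟨n, hn, ω, hω⟩ := h.exists_algHom_matrix k.pos S
    obtain ⟨φ', -⟩ := hS ω hω
    obtain ⟨j, -, hj, -⟩ := Matrix.exists_eq_conj_repeat φ'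
    simp only [Fintype.card_fin] at hj
    have hdvd : (m : ℕ) ∣ (k * n : ℕ+) := ⟨j, by rw [PNat.mul_coe, hj]⟩
    have hle := (Nat.factorization_le_iff_dvd m.ne_zero (k * n).ne_zero).2 hdvd p
    refine le_trans ?_ (add_le_add_right (le_exponent_steinitzNumber hn p) _)
    rw [hfac] at hle
    exact_mod_cast hle
  · refine h.add_exponent_le fun n hn => ?_
    obtain ⟨φ⟩ := mem_matrixDegrees_iff.1 hn
    have hmem : k * n ∈ matrixDegrees F (Matrix (Fin k) (Fin k) A) :=
      mem_matrixDegrees_of_algHom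
        (φ.mapMatrix.comp (Matrix.compAlgEquiv (Fin k) (Fin n) F F).symm.toAlgHom) (by simp)
    refine le_trans ?_ (le_exponent_steinitzNumber hmem p)
    exact_mod_cast (hfac n).ge

end IsLocallyMatrixAlgebra
end Corner

/-! ### Ring isomorphisms and Morita equivalence -/

section RingInvariance

variable {F : Type v} [Field F] {A B : Type u} [Ring A] [Algebra F A] [Ring B] [Algebra F B]

/-- A complete system of matrix units in an algebra gives a homomorphism from matrices. -/
theorem Matrix.nonempty_algHom_of_matrixUnits {ι : Type*} [Fintype ι] [DecidableEq ι]
    {u : ι → ι → B} (hu : ∀ i j k l, u i j * u k l = if j = k then u i l else 0)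
    (hu1 : ∑ i, u i i = 1) : Nonempty (Matrix ι ι F →ₐ[F] B) := by
  let f : Matrix ι ι F →ₗ[F] B :=
    { toFun := fun a => ∑ i, ∑ j, a i j • u i j
      map_add' := fun a b => by simp [add_smul, Finset.sum_add_distrib]
      map_smul' := fun c a => by simp [mul_smul, Finset.smul_sum] }
  refine ⟨AlgHom.ofLinearMap f ?_ fun a b => ?_⟩
  · change ∑ i, ∑ j, (1 : Matrix ι ι F) i j • u i j = 1
    simp [Matrix.one_apply, hu1]
  · change ∑ i, ∑ l, (a * b) i l • u i l = (∑ i, ∑ j, a i j • u i j) * ∑ k, ∑ l, b k l • u k l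
    simp_rw [Finset.sum_mul, Finset.mul_sum, smul_mul_smul_comm, hu, Matrix.mul_apply,
      Finset.sum_smul]
    refine Finset.sum_congr rfl fun i _ => ?_
    rw [Finset.sum_comm]
    refine Finset.sum_congr rfl fun j _ => ?_
    rw [Finset.sum_comm]
    simp

/-- Matrix degrees are detected by matrix units, so they do not depend on the scalars: they are
carried along by ring isomorphisms, linear or not. -/
theorem matrixDegrees_subset_of_ringEquiv [Nontrivial A] (e : A ≃+* B) :
    matrixDegrees F A ⊆ matrixDegrees F B := by
  intro n hn
  have : Nontrivial B := e.symm.toEquiv.nontrivial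
  obtain ⟨φ⟩ := mem_matrixDegrees_iff.1 hn
  refine mem_matrixDegrees_iff.2 (Matrix.nonempty_algHom_of_matrixUnits
    (u := fun i j => e (φ (Matrix.single i j 1))) (fun i j k l => ?_) ?_)
  · rw [← map_mul, ← map_mul]
    split_ifs with h
    · subst h; simp
    · simp [Matrix.single_mul_single_of_ne _ _ _ _ h]
  · rw [← map_sum, ← map_sum, Matrix.sum_single_eq_diagonal]
    simp

theorem steinitzNumber_eq_of_ringEquiv [Nontrivial A] (e : A ≃+* B) :
    steinitzNumber F A = steinitzNumber F B := by
  have : Nontrivial B := e.symm.toEquiv.nontrivial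
  exact congrArg SteinitzNumber.lcm ((matrixDegrees_subset_of_ringEquiv e).antisymm
    (matrixDegrees_subset_of_ringEquiv e.symm))

end RingInvariance

section Morita

open CategoryTheory

variable {A B : Type u} [Ring A] [Ring B]

theorem OrderIso.isCompactElement_apply {α β : Type*} [PartialOrder α] [PartialOrder β]
    (f : α ≃o β) {k : α} (hk : IsCompactElement k) : IsCompactElement (f k) := by
  intro s u hs hd hu hle
  obtain ⟨x, ⟨y, hy, rfl⟩, hx⟩ := hk (f.symm '' s) (f.symm u) (hs.image _)
    (hd.mono_comp fun _ _ h => f.symm.monotone h) (f.symm.isLUB_image'.2 hu) (f.le_symm_apply.2 hle)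
  exact ⟨y, hy, f.le_symm_apply.1 hx⟩

/-- Finite generation is compactness of the top element of the lattice of subobjects, so it is
preserved by equivalences of module categories. -/
theorem CategoryTheory.Equivalence.finite_moduleCat_obj (E : ModuleCat.{u} A ≌ ModuleCat.{u} B)
    (M : ModuleCat.{u} A) [Module.Finite A M] : Module.Finite B (E.functor.obj M) := by
  let f : Submodule A M ≃o Submodule B (E.functor.obj M) :=
    M.subobjectModule.symm.trans ((Subobject.lowerEquivalence (MonoOver.congr M E)).toOrderIso.trans
      (E.functor.obj M).subobjectModule)
  have h : IsCompactElement (⊤ : Submodule A M) :=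
    (Submodule.fg_iff_compact _).1 Module.Finite.fg_top
  have h' := f.isCompactElement_apply h
  rw [f.map_top] at h'
  exact ⟨(Submodule.fg_iff_compact _).2 h'⟩

theorem CategoryTheory.Equivalence.projective_moduleCat_obj
    (E : ModuleCat.{u} A ≌ ModuleCat.{u} B) (M : ModuleCat.{u} A) [Module.Projective A M] :
    Module.Projective B (E.functor.obj M) := by
  have : Projective M := (IsProjective.iff_projective M).1 inferInstance
  exact (IsProjective.iff_projective (E.functor.obj M)).2 ((E.map_projective_iff M).2 this)

/-- An equivalence of module categories identifies the endomorphism rings of corresponding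
modules; it is automatically additive. -/
noncomputable def CategoryTheory.Equivalence.endModuleCatEquiv
    (E : ModuleCat.{u} A ≌ ModuleCat.{u} B) (M : ModuleCat.{u} A) :
    Module.End A M ≃+* Module.End B (E.functor.obj M) :=
  have : E.functor.Additive := E.functor.additive_of_preserves_binary_products
  let φ : End M ≃+* End (E.functor.obj M) :=
    { E.fullyFaithfulFunctor.mulEquivEnd M with
      map_add' := fun _ _ => E.functor.map_add }
  M.endRingEquiv.symm.trans (φ.trans (E.functor.obj M).endRingEquiv)

open MulOpposite in
/-- The endomorphism ring of a direct summand `P` of a module `M`, with inclusion `i` and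
projection `p`, is a corner of the endomorphism ring of `M`. Both are replaced by their opposites
here, and that of `M` by an isomorphic ring `R`. -/
noncomputable def cornerEquivEndOp {M P : Type*} [AddCommGroup M] [Module B M] [AddCommGroup P]
    [Module B P] {R : Type*} [Ring R] (t : R ≃+* (Module.End B M)ᵐᵒᵖ) (i : P →ₗ[B] M)
    (p : M →ₗ[B] P) (hpi : p ∘ₗ i = LinearMap.id)
    (he : IsIdempotentElem (t.symm (op (i ∘ₗ p)))) :
    (Module.End B P)ᵐᵒᵖ ≃+* he.Corner where
  toFun g := ⟨t.symm (op (i ∘ₗ g.unop ∘ₗ p)), (Subsemigroup.mem_corner_iff he).2 ⟨by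
    rw [← map_mul, ← op_mul, Module.End.mul_eq_comp, LinearMap.comp_assoc, LinearMap.comp_assoc,
      ← LinearMap.comp_assoc p i p, hpi, LinearMap.id_comp], by
    rw [← map_mul, ← op_mul, Module.End.mul_eq_comp, LinearMap.comp_assoc,
      ← LinearMap.comp_assoc _ i p, hpi, LinearMap.id_comp]⟩⟩
  invFun x := op (p ∘ₗ (t x.1).unop ∘ₗ i)
  left_inv g := by
    apply unop_injective
    ext v
    have h (w : P) : p (i w) = w := LinearMap.congr_fun hpi w
    simp [h]
  right_inv x := by
    apply Subtype.ext
    change t.symm (op (i ∘ₗ (p ∘ₗ (t x.1).unop ∘ₗ i) ∘ₗ p)) = x.1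
    obtain ⟨h1, h2⟩ := (Subsemigroup.mem_corner_iff he).1 x.2
    have h : op (i ∘ₗ (p ∘ₗ (t x.1).unop ∘ₗ i) ∘ₗ p) =
        op (i ∘ₗ p) * (t x.1) * op (i ∘ₗ p) := rfl
    rw [h, map_mul, map_mul, t.symm_apply_apply, h1, h2]
  map_mul' f g := by
    apply Subtype.ext
    change t.symm _ = t.symm _ * t.symm _
    rw [← map_mul, ← op_mul]
    congr 2
    ext v
    have h (w : P) : p (i w) = w := LinearMap.congr_fun hpi w
    simp [h]
  map_add' f g := by
    apply Subtype.ext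
    change t.symm _ = t.symm _ + t.symm _
    rw [← map_add, ← MulOpposite.op_add]
    congr 2
    ext v
    simp

open MulOpposite in
/-- One half of Morita's theorem: a ring Morita equivalent to `B` is a corner of a matrix ring
over `B`. The module over `B` that corresponds to the regular module is finitely generated and
projective, so it is a direct summand of some `B ^ k`. -/
theorem AreMoritaEquivalent.exists_ringEquiv_corner (h : AreMoritaEquivalent A B) :
    ∃ (k : ℕ) (e : Matrix (Fin k) (Fin k) B) (he : IsIdempotentElem e),
      Nonempty (A ≃+* he.Corner) := by
  obtain ⟨E⟩ := h
  let P := E.functor.obj (ModuleCat.of A A)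
  have : Module.Finite A (ModuleCat.of A A) := inferInstanceAs (Module.Finite A A)
  have : Module.Projective A (ModuleCat.of A A) := inferInstanceAs (Module.Projective A A)
  have hfin : Module.Finite B P := E.finite_moduleCat_obj (ModuleCat.of A A)
  have hproj : Module.Projective B P := E.projective_moduleCat_obj (ModuleCat.of A A)
  obtain ⟨k, p, hp⟩ := Module.Finite.exists_fin' B P
  obtain ⟨i, hi⟩ := Module.projective_lifting_property p LinearMap.id hp
  let t : Matrix (Fin k) (Fin k) B ≃+* (Module.End B (Fin k → B))ᵐᵒᵖ :=
    matrixRingEquivEndVecMulOpposite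
  have he : IsIdempotentElem (t.symm (op (i ∘ₗ p))) := by
    rw [IsIdempotentElem, ← map_mul, ← op_mul, Module.End.mul_eq_comp, LinearMap.comp_assoc,
      ← LinearMap.comp_assoc p i p, hi, LinearMap.id_comp]
  exact ⟨k, _, he, ⟨(RingEquiv.opOp A).trans ((RingEquiv.moduleEndSelf A).trans
    (E.endModuleCatEquiv (ModuleCat.of A A))).op |>.trans (cornerEquivEndOp t i p hi he)⟩⟩

end Morita

/-! ### Ratios of Steinitz numbers and proper corners -/

section RatioAndCorners

variable {F : Type v} [Field F] {A : Type u} [Ring A] [Algebra F A]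

/-- The Steinitz number of a corner is a rational multiple of that of the whole algebra, and the
factor is less than one when the corner is proper. -/
theorem IsLocallyMatrixAlgebra.exists_steinitzNumber_corner (h : IsLocallyMatrixAlgebra F A)
    {e : A} (he : IsIdempotentElem e) (h0 : e ≠ 0) :
    ∃ m n : ℕ+, (e ≠ 1 → m < n) ∧ SteinitzNumber.ofPNat n * steinitzNumber F he.Corner =
      SteinitzNumber.ofPNat m * steinitzNumber F A := by
  have := h.nontrivial
  obtain ⟨n, r, ψ, P, Q, -, hQP, hψ⟩ := h.exists_splitting he ∅
  have hn : 0 < n := Fin.pos_iff_nonempty.2 (Matrix.nonempty_of_algHom ψ)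
  have hr : 0 < r := by
    by_contra hr
    obtain rfl : r = 0 := by omega
    have hPQ : P * Q = 0 := by ext; simp [Matrix.mul_apply]
    exact h0 (by rw [← hψ, hPQ, map_zero])
  refine ⟨⟨r, hr⟩, ⟨n, hn⟩, fun h1 => ?_, h.steinitzNumber_corner he (n := ⟨n, hn⟩) (r := ⟨r, hr⟩)
    ψ hQP hψ⟩
  have hrn : r ≤ n := by
    have h1 := Matrix.rank_mul_le_right Q P
    rw [hQP, Matrix.rank_one, Fintype.card_fin] at h1
    exact h1.trans (Matrix.rank_le_height P)
  refine lt_of_le_of_ne hrn fun hrn' => h1 ?_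
  obtain rfl : r = n := congrArg PNat.val hrn'
  rw [← hψ, mul_eq_one_comm.1 hQP, map_one]

theorem IsCountableLocallyMatrixAlgebra.corner (h : IsCountableLocallyMatrixAlgebra F A) {e : A}
    (he : IsIdempotentElem e) (h0 : e ≠ 0) : IsCountableLocallyMatrixAlgebra F he.Corner := by
  refine ⟨h.1.corner he h0, le_trans ?_ h.2⟩
  let f : he.Corner →ₗ[F] A :=
    { toFun := Subtype.val
      map_add' := fun _ _ => rfl
      map_smul' := fun _ _ => rfl }
  exact LinearMap.rank_le_of_injective f Subtype.val_injective

/-- The corner is cut out by a diagonal idempotent of rank `m` in a matrix subalgebra of degree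
`n`. -/
theorem IsLocallyMatrixAlgebra.exists_corner (h : IsLocallyMatrixAlgebra F A) {m n : ℕ+}
    (hmn : m < n) (hn : n ∈ matrixDegrees F A) :
    ∃ (e : A) (he : IsIdempotentElem e), e ≠ 0 ∧ e ≠ 1 ∧
      SteinitzNumber.ofPNat n * steinitzNumber F he.Corner =
        SteinitzNumber.ofPNat m * steinitzNumber F A := by
  have := h.nontrivial
  obtain ⟨ψ⟩ := mem_matrixDegrees_iff.1 hn
  let f : Fin m → Fin n := Fin.castLE hmn.le
  let P : Matrix (Fin n) (Fin m) F := (1 : Matrix (Fin n) (Fin n) F).submatrix id f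
  let Q : Matrix (Fin m) (Fin n) F := (1 : Matrix (Fin n) (Fin n) F).submatrix f id
  have hQP : Q * P = 1 := by
    rw [← Matrix.submatrix_mul _ _ _ _ _ Function.bijective_id, Matrix.one_mul]
    exact Matrix.submatrix_one f (Fin.castLE_injective hmn.le)
  have he : IsIdempotentElem (ψ (P * Q)) := by
    rw [IsIdempotentElem, ← map_mul, Matrix.mul_assoc, ← Matrix.mul_assoc Q, hQP, Matrix.one_mul]
  have hinj := Matrix.algHom_injective ψ
  refine ⟨ψ (P * Q), he, fun h0 => ?_, fun h1 => ?_, h.steinitzNumber_corner he ψ hQP rfl⟩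
  · have hPQ : P * Q = 0 := hinj (by rw [h0, map_zero])
    have h1 : (1 : Matrix (Fin m) (Fin m) F) = 0 := by
      rw [← hQP, ← Matrix.mul_one (Q * P), ← hQP, Matrix.mul_assoc, ← Matrix.mul_assoc P, hPQ,
        Matrix.zero_mul, Matrix.mul_zero]
    exact one_ne_zero h1
  · have hPQ : P * Q = 1 := hinj (by rw [h1, map_one])
    have := Matrix.square_of_invertible P Q hPQ hQP
    simp only [Fintype.card_fin] at this
    exact hmn.ne (PNat.eq this.symm)

variable {A₁ A₂ : Type u} [Ring A₁] [Algebra F A₁] [Ring A₂] [Algebra F A₂]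

/-- The equivalence of module categories need not be `F`-linear: the isomorphism of `A₁` with a
corner of a matrix ring over `A₂` that it provides is only one of rings, which is enough because
Steinitz numbers are invariant under ring isomorphisms. -/
theorem AreMoritaEquivalent.rationallyConnected (h₁ : IsLocallyMatrixAlgebra F A₁)
    (h₂ : IsLocallyMatrixAlgebra F A₂) (h : AreMoritaEquivalent A₁ A₂) :
    (steinitzNumber F A₁).RationallyConnected (steinitzNumber F A₂) := by
  have := h₁.nontrivial
  obtain ⟨k, e, he, ⟨ε⟩⟩ := h.exists_ringEquiv_corner
  have : Nontrivial he.Corner := ε.symm.toEquiv.nontrivial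
  have h0 : e ≠ 0 := fun h0 => one_ne_zero (α := he.Corner) (Subtype.ext h0)
  have hk : 0 < k := by
    by_contra hk
    obtain rfl : k = 0 := by omega
    exact h0 (Subsingleton.elim _ _)
  obtain ⟨k, rfl⟩ : ∃ k' : ℕ+, (k' : ℕ) = k := ⟨⟨k, hk⟩, rfl⟩
  obtain ⟨m, n, -, hmn⟩ := (h₂.matrix hk).exists_steinitzNumber_corner he h0
  rw [h₂.steinitzNumber_matrix, ← mul_assoc, ← SteinitzNumber.ofPNat_mul,
    ← steinitzNumber_eq_of_ringEquiv ε] at hmn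
  exact .of_mul_eq hmn

theorem AreMoritaEquivalent.symm (h : AreMoritaEquivalent A₁ A₂) : AreMoritaEquivalent A₂ A₁ :=
  h.map CategoryTheory.Equivalence.symm

theorem AreMoritaEquivalent.trans {A₃ : Type u} [Ring A₃] (h : AreMoritaEquivalent A₁ A₂)
    (h' : AreMoritaEquivalent A₂ A₃) : AreMoritaEquivalent A₁ A₃ :=
  h.map2 CategoryTheory.Equivalence.trans h'

theorem ratioLTOne_iff_isIsomorphicToProperCorner (h₁ : IsCountableLocallyMatrixAlgebra F A₁)
    (h₂ : IsCountableLocallyMatrixAlgebra F A₂) :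
    (steinitzNumber F A₁).RatioLTOne (steinitzNumber F A₂) ↔
      IsIsomorphicToProperCorner F A₁ A₂ := by
  have := h₁.1.nontrivial
  constructor
  · intro h
    obtain ⟨m, n, hmn, hc, h⟩ := h.exists_mul_eq
    -- As `m` and `n` are coprime, `n * st A₁ = m * st A₂` forces `n` to divide `st A₂`.
    have hn : n ∈ matrixDegrees F A₂ := h₂.1.mem_matrixDegrees_of_le fun p => by
      by_cases hp : (p : ℕ) ∣ n
      · have hpm : (m : ℕ).factorization p = 0 := Nat.factorization_eq_zero_of_not_dvd fun hpm =>
          p.2.one_lt.ne' (Nat.eq_one_of_dvd_coprimes hc hpm hp)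
        have h' := SteinitzNumber.exponent_add_eq h p
        rw [hpm, Nat.cast_zero, zero_add] at h'
        exact h' ▸ le_self_add
      · simp [Nat.factorization_eq_zero_of_not_dvd hp]
    obtain ⟨e, he, h0, h1, he'⟩ := h₂.1.exists_corner hmn hn
    exact ⟨e, he, h1, h₁.nonempty_algEquiv (h₂.corner he h0)
      (SteinitzNumber.ofPNat_mul_cancel (h.trans he'.symm))⟩
  · rintro ⟨e, he, h1, ⟨ε⟩⟩
    have : Nontrivial he.Corner := ε.symm.toEquiv.nontrivial
    have h0 : e ≠ 0 := fun h0 => one_ne_zero (α := he.Corner) (Subtype.ext h0)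
    obtain ⟨m, n, hmn, h⟩ := h₂.1.exists_steinitzNumber_corner he h0
    rw [← steinitzNumber_eq_of_ringEquiv ε.toRingEquiv] at h
    exact .of_mul_eq (hmn h1) h

end RatioAndCorners

theorem mainTheorem3 (F : Type v) [Field F] :
    -- the ratio of Steinitz numbers and proper corners
    (∀ (A₁ A₂ : Type u) [Ring A₁] [Algebra F A₁] [Ring A₂] [Algebra F A₂],
      IsCountableLocallyMatrixAlgebra F A₁ → IsCountableLocallyMatrixAlgebra F A₂ →
      AreMoritaEquivalent A₁ A₂ →
        (steinitzNumber F A₁).RationallyConnected (steinitzNumber F A₂) ∧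
        ((steinitzNumber F A₁).RatioLTOne (steinitzNumber F A₂) ↔
          IsIsomorphicToProperCorner F A₁ A₂)) ∧
    -- the order on a Morita class
    (∀ (A : Type u) [Ring A] [Algebra F A], IsCountableLocallyMatrixAlgebra F A →
      -- any two members are comparable
      (∀ (A₁ A₂ : Type u) [Ring A₁] [Algebra F A₁] [Ring A₂] [Algebra F A₂],
        InMoritaClass F A A₁ → InMoritaClass F A A₂ →
          SteinitzLT F A₁ A₂ ∨ Nonempty (A₁ ≃ₐ[F] A₂) ∨ SteinitzLT F A₂ A₁) ∧
      -- transitivity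
      (∀ (A₁ A₂ A₃ : Type u) [Ring A₁] [Algebra F A₁] [Ring A₂] [Algebra F A₂]
        [Ring A₃] [Algebra F A₃],
        InMoritaClass F A A₁ → InMoritaClass F A A₂ → InMoritaClass F A A₃ →
          SteinitzLT F A₁ A₂ → SteinitzLT F A₂ A₃ → SteinitzLT F A₁ A₃) ∧
      -- if `st(A)` is locally finite, ratios are unique and the order is strict
      ((steinitzNumber F A).IsLocallyFinite →
        ∀ (A₁ A₂ : Type u) [Ring A₁] [Algebra F A₁] [Ring A₂] [Algebra F A₂],
        InMoritaClass F A A₁ → InMoritaClass F A A₂ →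
          (∃! q : ℚ, SteinitzNumber.IsRatio q (steinitzNumber F A₁) (steinitzNumber F A₂)) ∧
          (SteinitzLT F A₁ A₂ → ¬ Nonempty (A₁ ≃ₐ[F] A₂) ∧ ¬ SteinitzLT F A₂ A₁))) := by
  refine ⟨fun A₁ A₂ _ _ _ _ h₁ h₂ hM => ⟨hM.rationallyConnected h₁.1 h₂.1,
    ratioLTOne_iff_isIsomorphicToProperCorner h₁ h₂⟩, fun A _ _ hA => ⟨?_, ?_, ?_⟩⟩
  · intro A₁ A₂ _ _ _ _ h₁ h₂
    have hM := h₁.2.symm.trans h₂.2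
    rcases (hM.rationallyConnected h₁.1.1 h₂.1.1).lt_or_eq_or_gt with h | h | h
    · exact Or.inl h
    · exact Or.inr (Or.inl (h₁.1.nonempty_algEquiv h₂.1 h))
    · exact Or.inr (Or.inr h)
  · intro A₁ A₂ A₃ _ _ _ _ _ _ _ _ _ h₁₂ h₂₃
    exact h₁₂.trans h₂₃
  · intro hfin A₁ A₂ _ _ _ _ h₁ h₂
    have hfin₁ := (h₁.2.rationallyConnected hA.1 h₁.1.1).isLocallyFinite hfin
    have hfin₂ := (h₂.2.rationallyConnected hA.1 h₂.1.1).isLocallyFinite hfin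
    obtain ⟨q, hq⟩ := (h₁.2.symm.trans h₂.2).rationallyConnected h₁.1.1 h₂.1.1
    refine ⟨⟨q, hq, fun q' hq' => hq'.unique hfin₁ hfin₂ hq⟩, fun hlt => ⟨?_, fun hgt => ?_⟩⟩
    · rintro ⟨ε⟩
      have := h₁.1.1.nontrivial
      have heq : steinitzNumber F A₁ = steinitzNumber F A₂ :=
        steinitzNumber_eq_of_ringEquiv ε.toRingEquiv
      exact SteinitzNumber.RatioLTOne.irrefl hfin₁ (by rwa [SteinitzLT, ← heq] at hlt)
    · exact SteinitzNumber.RatioLTOne.irrefl hfin₁ (hlt.trans hgt)
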